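/- For $R>0$, an $R$-body in $\mathbb{R}^3$ is the complement of a nonempty union of open balls of radius $R$, and the $R$-hulloid $co_R(S)$ of a set $S$ is the smallest $R$-body containing $S$, that is, the intersection of all $R$-bodies containing $S$. Let $0<\eta<\frac{12}{5}$, and let $T\subset\mathbb{R}^3$ be a nondegenerate tetrahedron with vertex set $V=\{v_0,v_1,v_2,v_3\}$ and circumradius $R_T$ that is a triangular pyramid with parameter $\eta$, i.e. $\|v_0-v_i\|=1$ for $i=1,2,3$ and $\|v_i-v_j\|^2=\eta$ for $1\le i<j\le 3$. Then there exists $r>R_T$ such that $co_r(V)=V$. -/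

import Mathlib

/-- `A` is an `R`-body: the complement of a nonempty union of open balls of radius `R`. -/
def IsRBody {E : Type*} [PseudoMetricSpace E] (R : ℝ) (A : Set E) : Prop :=
  ∃ C : Set E, C.Nonempty ∧ A = (⋃ c ∈ C, Metric.ball c R)ᶜ

/-- The `R`-hulloid `co_R(S)` of `S`: the intersection of all the `R`-bodies that contain `S`.
It is the least such `R`-body as soon as there is one (`isLeast_rHulloid`). -/
def rHulloid {E : Type*} [PseudoMetricSpace E] (R : ℝ) (S : Set E) : Set E :=
  ⋂₀ {A : Set E | IsRBody R A ∧ S ⊆ A}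

theorem isLeast_rHulloid {E : Type*} [PseudoMetricSpace E] {R : ℝ} {S : Set E}
    (h : ∃ A : Set E, IsRBody R A ∧ S ⊆ A) :
    IsLeast {A : Set E | IsRBody R A ∧ S ⊆ A} (rHulloid R S) := by
  refine ⟨⟨⟨{c : E | Disjoint (Metric.ball c R) S}, ?_, ?_⟩, ?_⟩, ?_⟩
  · obtain ⟨A, ⟨C, ⟨c, hc⟩, rfl⟩, hS⟩ := h
    refine ⟨c, Set.disjoint_left.2 fun x hx hxS => hS hxS ?_⟩
    exact Set.mem_iUnion₂.2 ⟨c, hc, hx⟩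
  · ext x
    simp only [rHulloid, Set.mem_sInter, Set.mem_ofPred_eq, Set.mem_compl_iff, Set.mem_iUnion,
      not_exists]
    constructor
    · intro hx c hc hxc
      refine hx (⋃ d ∈ ({c} : Set E), Metric.ball d R)ᶜ
        ⟨⟨{c}, Set.singleton_nonempty c, rfl⟩, fun y hy hyc => ?_⟩
        (Set.mem_iUnion₂.2 ⟨c, rfl, hxc⟩)
      obtain ⟨d, hd, hyd⟩ := Set.mem_iUnion₂.1 hyc
      rw [Set.mem_singleton_iff.1 hd] at hyd
      exact Set.disjoint_left.1 hc hyd hy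
    · rintro hx A ⟨⟨C, -, rfl⟩, hS⟩ hxC
      obtain ⟨c, hc, hxc⟩ := Set.mem_iUnion₂.1 hxC
      exact hx c (Set.disjoint_left.2 fun y hy hyS => hS hyS (Set.mem_iUnion₂.2 ⟨c, hc, hy⟩)) hxc
  · exact fun y hy A hA => hA.2 hy
  · exact fun A hA => Set.sInter_subset_of_mem hA

/-- A tetrahedron `T` with vertices `v₀, v₁, v₂, v₃` is a triangular pyramid with parameters
`lam` and `eta`: the apex `v₀` is at squared distance `lam` from each of `v₁, v₂, v₃`, and the
base `v₁ v₂ v₃` is equilateral with squared edge length `eta`. -/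
structure IsTriangularPyramid (T : Affine.Simplex ℝ (EuclideanSpace ℝ (Fin 3)) 3)
    (lam eta : ℝ) : Prop where
  lateral : ∀ i : Fin 4, i ≠ 0 → dist (T.points 0) (T.points i) ^ 2 = lam
  base : ∀ i j : Fin 4, i ≠ 0 → j ≠ 0 → i ≠ j → dist (T.points i) (T.points j) ^ 2 = eta

/-! A point leaves the hulloid once some open ball of radius at least `r` contains it and misses
`V`. Nearly half-space balls reduce the problem to the tetrahedron itself
(`rHulloid_subset_of_isCompact_convex`). There, with barycentric weights `lᵢ` and `s = l₁ + l₂ +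
l₃`, a point has power `-N` with respect to the circumsphere, `N = s(1 - s) + eta(l₁l₂ + l₁l₃ +
l₂l₃)`, and `N > 0` off the vertices.

A sphere through a lateral face giving the fourth vertex power `F ≥ 0` bounds a ball missing `V`; it
contains the point iff `F lᵢ < N`, `lᵢ` being the opposite weight. Its radius exceeds `R_T` when `F
> 2eta/(4 - eta)`, the value for the circumsphere reflected in the face. Near the apex the three
such balls cover when `F < 3`, and `2eta/(4 - eta) < 3` is exactly `eta < 12/5`. A ball through the
base handles the remaining points when `eta ≥ 2`. -/

/-! ### Excluding points from a hulloid by balls. -/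

/-- The homothety with center `x` and ratio `r / ρ` shrinks the large ball to one of radius `r`
inside it that still contains `x`. -/
theorem notMem_rHulloid_of_mem_ball {E : Type*} [NormedAddCommGroup E] [NormedSpace ℝ E]
    {r ρ : ℝ} {S : Set E} {x c : E} (hr : 0 < r) (hrρ : r ≤ ρ) (hS : ∀ v ∈ S, ρ ≤ dist c v)
    (hx : dist x c < ρ) : x ∉ rHulloid r S := by
  have hρ : 0 < ρ := hr.trans_le hrρ
  have h1 : dist x (x + (r / ρ) • (c - x)) = r / ρ * dist x c := by
    rw [dist_eq_norm, dist_eq_norm', sub_add_cancel_left, norm_neg, norm_smul, Real.norm_of_nonneg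
      (by positivity)]
  have h2 : dist c (x + (r / ρ) • (c - x)) = (1 - r / ρ) * dist x c := by
    rw [dist_eq_norm, dist_eq_norm', ← Real.norm_of_nonneg (sub_nonneg.2 ((div_le_one hρ).2 hrρ)),
      ← norm_smul]
    congr 1
    module
  intro h
  refine h (⋃ d ∈ ({x + (r / ρ) • (c - x)} : Set E), Metric.ball d r)ᶜ
    ⟨⟨_, Set.singleton_nonempty _, rfl⟩, fun v hv hvc => ?_⟩ ?_
  · simp only [Set.mem_singleton_iff, Set.iUnion_iUnion_eq_left, Metric.mem_ball] at hvc
    have h3 := hS v hv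
    have h4 := dist_triangle c (x + (r / ρ) • (c - x)) v
    rw [dist_comm] at hvc
    have h5 : (1 - r / ρ) * dist x c ≤ (1 - r / ρ) * ρ :=
      mul_le_mul_of_nonneg_left hx.le (sub_nonneg.2 ((div_le_one hρ).2 hrρ))
    have h6 : (1 - r / ρ) * ρ = ρ - r := by field_simp
    linarith
  · simp only [Set.mem_singleton_iff, Set.iUnion_iUnion_eq_left, Metric.mem_ball]
    rw [h1]
    calc r / ρ * dist x c < r / ρ * ρ := by gcongr
      _ = r := by field_simp

/-- If `p` is the point of `K` nearest to `x`, a ball through `p` centered on the ray from `p`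
through `x` is tangent to a supporting hyperplane, so it misses `K`. -/
theorem rHulloid_subset_of_isCompact_convex {E : Type*} [NormedAddCommGroup E]
    [InnerProductSpace ℝ E] {r : ℝ} {S K : Set E} (hr : 0 < r) (hne : S.Nonempty) (hSK : S ⊆ K)
    (hK : IsCompact K) (hc : Convex ℝ K) : rHulloid r S ⊆ K := by
  intro x hx
  by_contra hxK
  obtain ⟨p, hp, hpx⟩ :=
    exists_norm_eq_iInf_of_complete_convex (hne.mono hSK) hK.isComplete hc x
  rw [norm_eq_iInf_iff_real_inner_le_zero hc hp] at hpx
  have hd : 0 < ‖x - p‖ := norm_pos_iff.2 (sub_ne_zero.2 fun h => hxK (h ▸ hp))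
  -- This makes the radius `t * ‖x - p‖` equal to `‖x - p‖ + r`.
  set t : ℝ := 1 + r / ‖x - p‖ with ht
  have ht1 : 1 ≤ t := by rw [ht]; linarith [div_pos hr hd]
  refine notMem_rHulloid_of_mem_ball (c := p + t • (x - p)) (ρ := t * ‖x - p‖) hr ?_ ?_ ?_ hx
  · rw [ht, add_mul, div_mul_cancel₀ _ hd.ne']
    linarith
  · intro v hv
    rw [dist_eq_norm]
    refine le_of_sq_le_sq ?_ (norm_nonneg _)
    have h1 : p + t • (x - p) - v = t • (x - p) - (v - p) := by abel
    rw [h1, norm_sub_sq_real, norm_smul, Real.norm_of_nonneg (by linarith), inner_smul_left]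
    have h2 := mul_nonpos_of_nonneg_of_nonpos (zero_le_one.trans ht1) (hpx v (hSK hv))
    simp only [conj_trivial]
    nlinarith [sq_nonneg ‖v - p‖]
  · have h1 : x - (p + t • (x - p)) = (1 - t) • (x - p) := by module
    rw [dist_eq_norm, h1, norm_smul, Real.norm_eq_abs, abs_of_nonpos (by linarith)]
    nlinarith

/-! ### Spheres through the faces of the pyramid. -/

section Pyramid

variable {E : Type*} [NormedAddCommGroup E] [InnerProductSpace ℝ E]

open scoped RealInnerProductSpace

/-- The edge vectors from the apex of a triangular pyramid with lateral edges `1` and squared base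
edges `eta`. -/
structure IsPyramidFrame (eta : ℝ) (e₁ e₂ e₃ : E) : Prop where
  inner₁₁ : ⟪e₁, e₁⟫ = 1
  inner₂₂ : ⟪e₂, e₂⟫ = 1
  inner₃₃ : ⟪e₃, e₃⟫ = 1
  inner₁₂ : ⟪e₁, e₂⟫ = 1 - eta / 2
  inner₁₃ : ⟪e₁, e₃⟫ = 1 - eta / 2
  inner₂₃ : ⟪e₂, e₃⟫ = 1 - eta / 2

namespace IsPyramidFrame

variable {eta : ℝ} {e₁ e₂ e₃ : E}

theorem rotate (h : IsPyramidFrame eta e₁ e₂ e₃) : IsPyramidFrame eta e₂ e₃ e₁ :=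
  ⟨h.inner₂₂, h.inner₃₃, h.inner₁₁, h.inner₂₃, real_inner_comm e₂ e₁ ▸ h.inner₁₂,
    real_inner_comm e₃ e₁ ▸ h.inner₁₃⟩

/-- The center of a sphere through the apex and two base vertices for which the third base vertex
has power `F`. -/
theorem exists_center (h : IsPyramidFrame eta e₁ e₂ e₃) (h0 : 0 < eta) (h3 : eta < 3) (F : ℝ) :
    ∃ w : E, ⟪e₁, w⟫ = 1 / 2 ∧ ⟪e₂, w⟫ = 1 / 2 ∧ ⟪e₃, w⟫ = (1 - F) / 2 ∧
      ‖w‖ ^ 2 = 3 / (4 * (3 - eta)) + F * (F * (4 - eta) - 2 * eta) / (4 * eta * (3 - eta)) := by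
  have h3' : 3 - eta ≠ 0 := by linarith
  have h4' : 4 - eta ≠ 0 := by linarith
  have h0' := h0.ne'
  -- The symmetry exchanging `e₁` and `e₂` suggests a center `a • (e₁ + e₂) + b • e₃`; `a` and `b`
  -- solve the resulting 2×2 linear system.
  obtain ⟨b, hb⟩ : ∃ b, b = (eta - F * (4 - eta)) / (2 * eta * (3 - eta)) := ⟨_, rfl⟩
  obtain ⟨a, ha⟩ : ∃ a, a = (1 - b * (2 - eta)) / (4 - eta) := ⟨_, rfl⟩
  have i1 : ⟪e₁, a • (e₁ + e₂) + b • e₃⟫ = 1 / 2 := by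
    simp only [inner_add_right, inner_smul_right, h.inner₁₁, h.inner₁₂, h.inner₁₃]
    rw [ha]; field_simp; ring
  have i2 : ⟪e₂, a • (e₁ + e₂) + b • e₃⟫ = 1 / 2 := by
    simp only [inner_add_right, inner_smul_right, h.inner₂₂, real_inner_comm e₁ e₂ ▸ h.inner₁₂,
      h.inner₂₃]
    rw [ha]; field_simp; ring
  have i3 : ⟪e₃, a • (e₁ + e₂) + b • e₃⟫ = (1 - F) / 2 := by
    simp only [inner_add_right, inner_smul_right, h.inner₃₃, real_inner_comm e₁ e₃,
      real_inner_comm e₂ e₃, h.inner₁₃, h.inner₂₃]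
    rw [ha, hb]; field_simp; ring
  refine ⟨a • (e₁ + e₂) + b • e₃, i1, i2, i3, ?_⟩
  rw [← real_inner_self_eq_norm_sq]
  nth_rewrite 1 [inner_add_left, inner_smul_left, inner_smul_left, inner_add_left]
  rw [i1, i2, i3, ha, hb]
  simp only [conj_trivial]
  field_simp
  ring

/-- The center of a sphere through the base vertices for which the apex has power `δ`. -/
theorem exists_axial_center (h : IsPyramidFrame eta e₁ e₂ e₃) (h3 : eta < 3) (δ : ℝ) :
    ∃ w : E, ⟪e₁, w⟫ = (1 + δ) / 2 ∧ ⟪e₂, w⟫ = (1 + δ) / 2 ∧ ⟪e₃, w⟫ = (1 + δ) / 2 ∧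
      ‖w‖ ^ 2 = 3 * (1 + δ) ^ 2 / (4 * (3 - eta)) := by
  have h3' : 3 - eta ≠ 0 := by linarith
  obtain ⟨y, hy⟩ : ∃ y, y = (1 + δ) / (2 * (3 - eta)) := ⟨_, rfl⟩
  have i1 : ⟪e₁, y • (e₁ + e₂ + e₃)⟫ = (1 + δ) / 2 := by
    simp only [inner_add_right, inner_smul_right, h.inner₁₁, h.inner₁₂, h.inner₁₃]
    rw [hy]; field_simp; ring
  have i2 : ⟪e₂, y • (e₁ + e₂ + e₃)⟫ = (1 + δ) / 2 := by
    simp only [inner_add_right, inner_smul_right, h.inner₂₂, h.inner₂₃, real_inner_comm e₁ e₂,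
      h.inner₁₂]
    rw [hy]; field_simp; ring
  have i3 : ⟪e₃, y • (e₁ + e₂ + e₃)⟫ = (1 + δ) / 2 := by
    simp only [inner_add_right, inner_smul_right, h.inner₃₃, real_inner_comm e₁ e₃,
      real_inner_comm e₂ e₃, h.inner₁₃, h.inner₂₃]
    rw [hy]; field_simp; ring
  refine ⟨y • (e₁ + e₂ + e₃), i1, i2, i3, ?_⟩
  rw [← real_inner_self_eq_norm_sq]
  nth_rewrite 1 [inner_smul_left, inner_add_left, inner_add_left]
  rw [i1, i2, i3, hy]
  simp only [conj_trivial]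
  field_simp
  ring

theorem norm_sub_sq_edge₁ (h : IsPyramidFrame eta e₁ e₂ e₃) (w : E) :
    ‖w - e₁‖ ^ 2 = ‖w‖ ^ 2 - 2 * ⟪e₁, w⟫ + 1 := by
  rw [norm_sub_sq_real, ← real_inner_self_eq_norm_sq e₁, h.inner₁₁, real_inner_comm]

theorem norm_combination_sub_sq (h : IsPyramidFrame eta e₁ e₂ e₃) (l₁ l₂ l₃ : ℝ) (w : E) :
    ‖l₁ • e₁ + l₂ • e₂ + l₃ • e₃ - w‖ ^ 2 =
      (l₁ + l₂ + l₃) ^ 2 - eta * (l₁ * l₂ + l₁ * l₃ + l₂ * l₃)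
        - 2 * (l₁ * ⟪e₁, w⟫ + l₂ * ⟪e₂, w⟫ + l₃ * ⟪e₃, w⟫) + ‖w‖ ^ 2 := by
  rw [norm_sub_sq_real, ← real_inner_self_eq_norm_sq]
  simp only [inner_add_left, inner_add_right, inner_smul_left, inner_smul_right, conj_trivial,
    h.inner₁₁, h.inner₂₂, h.inner₃₃, h.inner₁₂, h.inner₁₃, h.inner₂₃, real_inner_comm e₁ e₂,
    real_inner_comm e₁ e₃, real_inner_comm e₂ e₃]
  ring

/-- A point is off the hulloid when it lies in the ball bounded by the sphere through the apex and
two base vertices for which the third base vertex has power `F`. -/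
theorem notMem_rHulloid_of_side (h : IsPyramidFrame eta e₁ e₂ e₃) (h0 : 0 < eta) (h3 : eta < 3)
    {F r l₁ l₂ l₃ : ℝ} (v : E) (hF : 0 ≤ F) (hr : 0 < r)
    (hrF : r ^ 2 ≤ 3 / (4 * (3 - eta)) + F * (F * (4 - eta) - 2 * eta) / (4 * eta * (3 - eta)))
    (hl : F * l₃ < (l₁ + l₂ + l₃) * (1 - (l₁ + l₂ + l₃)) +
      eta * (l₁ * l₂ + l₁ * l₃ + l₂ * l₃)) :
    v + (l₁ • e₁ + l₂ • e₂ + l₃ • e₃) ∉ rHulloid r {v, v + e₁, v + e₂, v + e₃} := by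
  obtain ⟨w, i1, i2, i3, hw⟩ := h.exists_center h0 h3 F
  rw [← hw] at hrF
  refine notMem_rHulloid_of_mem_ball (c := v + w) (ρ := ‖w‖) hr
    (le_of_sq_le_sq hrF (norm_nonneg _)) ?_ ?_
  · rintro u (rfl | rfl | rfl | rfl)
    · simp
    · rw [dist_add_left, dist_eq_norm]
      refine le_of_sq_le_sq ?_ (norm_nonneg _)
      rw [h.norm_sub_sq_edge₁, i1]; linarith
    · rw [dist_add_left, dist_eq_norm]
      refine le_of_sq_le_sq ?_ (norm_nonneg _)
      rw [h.rotate.norm_sub_sq_edge₁, i2]; linarith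
    · rw [dist_add_left, dist_eq_norm]
      refine le_of_sq_le_sq ?_ (norm_nonneg _)
      rw [h.rotate.rotate.norm_sub_sq_edge₁, i3]; linarith
  · rw [dist_add_left, dist_eq_norm]
    refine lt_of_pow_lt_pow_left₀ 2 (norm_nonneg _) ?_
    rw [h.norm_combination_sub_sq, i1, i2, i3]
    linarith

/-- A point is off the hulloid when it lies in the ball bounded by the sphere through the base
vertices for which the apex has power `δ`. -/
theorem notMem_rHulloid_of_base (h : IsPyramidFrame eta e₁ e₂ e₃) (h3 : eta < 3)
    {δ r l₁ l₂ l₃ : ℝ} (v : E) (hδ : 0 ≤ δ) (hr : 0 < r)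
    (hrδ : r ^ 2 ≤ 3 * (1 + δ) ^ 2 / (4 * (3 - eta)) - δ)
    (hl : δ * (1 - (l₁ + l₂ + l₃)) < (l₁ + l₂ + l₃) * (1 - (l₁ + l₂ + l₃)) +
      eta * (l₁ * l₂ + l₁ * l₃ + l₂ * l₃)) :
    v + (l₁ • e₁ + l₂ • e₂ + l₃ • e₃) ∉ rHulloid r {v, v + e₁, v + e₂, v + e₃} := by
  obtain ⟨w, i1, i2, i3, hw⟩ := h.exists_axial_center h3 δ
  rw [← hw] at hrδ
  have hρ : √(‖w‖ ^ 2 - δ) ^ 2 = ‖w‖ ^ 2 - δ := Real.sq_sqrt ((sq_nonneg r).trans hrδ)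
  refine notMem_rHulloid_of_mem_ball (c := v + w) (ρ := √(‖w‖ ^ 2 - δ)) hr
    (Real.le_sqrt_of_sq_le hrδ) ?_ ?_
  · rintro u (rfl | rfl | rfl | rfl)
    · rw [dist_self_add_left]
      refine le_of_sq_le_sq ?_ (norm_nonneg _)
      rw [hρ]; linarith
    · rw [dist_add_left, dist_eq_norm]
      refine le_of_sq_le_sq ?_ (norm_nonneg _)
      rw [hρ, h.norm_sub_sq_edge₁, i1]; linarith
    · rw [dist_add_left, dist_eq_norm]
      refine le_of_sq_le_sq ?_ (norm_nonneg _)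
      rw [hρ, h.rotate.norm_sub_sq_edge₁, i2]; linarith
    · rw [dist_add_left, dist_eq_norm]
      refine le_of_sq_le_sq ?_ (norm_nonneg _)
      rw [hρ, h.rotate.rotate.norm_sub_sq_edge₁, i3]; linarith
  · rw [dist_add_left, dist_eq_norm]
    refine lt_of_pow_lt_pow_left₀ 2 (Real.sqrt_nonneg _) ?_
    rw [hρ, h.norm_combination_sub_sq, i1, i2, i3]
    linarith

/-- By the threefold symmetry, the lateral face opposite the smallest weight can be used. -/
theorem notMem_rHulloid_of_sides (h : IsPyramidFrame eta e₁ e₂ e₃) (h0 : 0 < eta) (h3 : eta < 3)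
    {F r l₁ l₂ l₃ : ℝ} (v : E) (hF : 0 ≤ F) (hr : 0 < r)
    (hrF : r ^ 2 ≤ 3 / (4 * (3 - eta)) + F * (F * (4 - eta) - 2 * eta) / (4 * eta * (3 - eta)))
    (hl : F * min l₁ (min l₂ l₃) < (l₁ + l₂ + l₃) * (1 - (l₁ + l₂ + l₃)) +
      eta * (l₁ * l₂ + l₁ * l₃ + l₂ * l₃)) :
    v + (l₁ • e₁ + l₂ • e₂ + l₃ • e₃) ∉ rHulloid r {v, v + e₁, v + e₂, v + e₃} := by
  rcases min_choice l₁ (min l₂ l₃) with h1 | h1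
  · have key := h.rotate.notMem_rHulloid_of_side (l₁ := l₂) (l₂ := l₃) (l₃ := l₁) h0 h3 v hF hr hrF
      (by rw [h1] at hl; linarith)
    have hV : ({v, v + e₁, v + e₂, v + e₃} : Set E) = {v, v + e₂, v + e₃, v + e₁} := by
      ext u
      simp only [Set.mem_insert_iff, Set.mem_singleton_iff]
      tauto
    have hx : l₁ • e₁ + l₂ • e₂ + l₃ • e₃ = l₂ • e₂ + l₃ • e₃ + l₁ • e₁ := by abel
    rwa [hV, hx]
  · rcases min_choice l₂ l₃ with h2 | h2
    · have key := h.rotate.rotate.notMem_rHulloid_of_side (l₁ := l₃) (l₂ := l₁) (l₃ := l₂) h0 h3 v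
        hF hr hrF (by rw [h1, h2] at hl; linarith)
      have hV : ({v, v + e₁, v + e₂, v + e₃} : Set E) = {v, v + e₃, v + e₁, v + e₂} := by
        ext u
        simp only [Set.mem_insert_iff, Set.mem_singleton_iff]
        tauto
      have hx : l₁ • e₁ + l₂ • e₂ + l₃ • e₃ = l₃ • e₃ + l₁ • e₁ + l₂ • e₂ := by abel
      rwa [hV, hx]
    · exact h.notMem_rHulloid_of_side h0 h3 v hF hr hrF (by rwa [h1, h2] at hl)

end IsPyramidFrame

/-! ### Covering the tetrahedron minus its vertices. -/

/-- With `m` the minimum, `s ≥ 3m` and `l₁l₂ + l₂l₃ + l₃l₁ ≥ s m`. The side balls thus cover a point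
with `m > 0` as soon as `F < 3(1 - s) + eta s`. -/
theorem mul_min_le_pyramid_power {eta l₁ l₂ l₃ : ℝ} (h0 : 0 ≤ eta) (h₁ : 0 ≤ l₁) (h₂ : 0 ≤ l₂)
    (h₃ : 0 ≤ l₃) (hs : l₁ + l₂ + l₃ ≤ 1) :
    (3 * (1 - (l₁ + l₂ + l₃)) + eta * (l₁ + l₂ + l₃)) * min l₁ (min l₂ l₃) ≤
      (l₁ + l₂ + l₃) * (1 - (l₁ + l₂ + l₃)) + eta * (l₁ * l₂ + l₁ * l₃ + l₂ * l₃) := by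
  obtain ⟨m, hm⟩ : ∃ m, m = min l₁ (min l₂ l₃) := ⟨_, rfl⟩
  have hm0 : 0 ≤ m := hm ▸ le_min h₁ (le_min h₂ h₃)
  have hm1 : m ≤ l₁ := hm ▸ min_le_left _ _
  have hm2 : m ≤ l₂ := hm ▸ (min_le_right _ _).trans (min_le_left _ _)
  have hm3 : m ≤ l₃ := hm ▸ (min_le_right _ _).trans (min_le_right _ _)
  rw [← hm]
  have k1 : 3 * m * (1 - (l₁ + l₂ + l₃)) ≤ (l₁ + l₂ + l₃) * (1 - (l₁ + l₂ + l₃)) :=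
    mul_le_mul_of_nonneg_right (by linarith) (by linarith)
  have k2 : (l₁ + l₂ + l₃) * m ≤ l₁ * l₂ + l₁ * l₃ + l₂ * l₃ := by
    have a1 := mul_le_mul_of_nonneg_left hm2 h₁
    have a2 := mul_le_mul_of_nonneg_left hm3 h₂
    have a3 := mul_le_mul_of_nonneg_left hm1 h₃
    linarith
  have k3 := mul_le_mul_of_nonneg_left k2 h0
  linarith

namespace IsPyramidFrame

variable {eta : ℝ} {e₁ e₂ e₃ : E}

theorem exists_radius (h : IsPyramidFrame eta e₁ e₂ e₃) (h0 : 0 < eta) (h1 : eta < 12 / 5)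
    (v : E) : ∃ r : ℝ, 0 < r ∧ 3 / (4 * (3 - eta)) < r ^ 2 ∧ ∀ l₁ l₂ l₃ : ℝ,
      0 ≤ l₁ → 0 ≤ l₂ → 0 ≤ l₃ → l₁ + l₂ + l₃ ≤ 1 →
      0 < (l₁ + l₂ + l₃) * (1 - (l₁ + l₂ + l₃)) + eta * (l₁ * l₂ + l₁ * l₃ + l₂ * l₃) →
      v + (l₁ • e₁ + l₂ • e₂ + l₃ • e₃) ∉ rHulloid r {v, v + e₁, v + e₂, v + e₃} := by
  have h3 : 0 < 3 - eta := by linarith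
  have h4 : 0 < 4 - eta := by linarith
  have hR : 0 < 3 / (4 * (3 - eta)) := by positivity
  have hF3 : 2 * eta / (4 - eta) < 3 := by rw [div_lt_iff₀ h4]; linarith
  have hside : ∀ F, 2 * eta / (4 - eta) < F → 0 < F ∧ 3 / (4 * (3 - eta)) <
      3 / (4 * (3 - eta)) + F * (F * (4 - eta) - 2 * eta) / (4 * eta * (3 - eta)) := by
    intro F hF
    have hF0 : 0 < F := lt_trans (by positivity) hF
    rw [div_lt_iff₀ h4] at hF
    have : 0 < F * (4 - eta) - 2 * eta := by linarith
    exact ⟨hF0, lt_add_of_pos_right _ (by positivity)⟩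
  rcases lt_or_ge eta 2 with h2 | h2
  -- For `eta < 2` some admissible `F` lies below both 3 and `eta`, hence below every `3(1 - s) +
  -- eta s`: the side balls suffice.
  · have hFe : 2 * eta / (4 - eta) < eta := by rw [div_lt_iff₀ h4]; nlinarith
    obtain ⟨F, hF1, hF2⟩ := exists_between (lt_min hF3 hFe)
    obtain ⟨hF0, hF4⟩ := hside F hF1
    rw [lt_min_iff] at hF2
    have hsq := Real.sq_sqrt (hR.trans hF4).le
    refine ⟨_, Real.sqrt_pos.2 (hR.trans hF4), hF4.trans_eq hsq.symm, ?_⟩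
    intro l₁ l₂ l₃ hl₁ hl₂ hl₃ hs hN
    refine h.notMem_rHulloid_of_sides h0 (by linarith) v hF0.le (Real.sqrt_pos.2 (hR.trans hF4))
      hsq.le ?_
    have key := mul_min_le_pyramid_power h0.le hl₁ hl₂ hl₃ hs
    rcases (le_min hl₁ (le_min hl₂ hl₃)).eq_or_lt with hm | hm
    · rwa [← hm, mul_zero]
    · refine (mul_lt_mul_of_pos_right ?_ hm).trans_le key
      nlinarith
  · obtain ⟨F, hF1, hF2⟩ := exists_between hF3
    obtain ⟨hF0, hF4⟩ := hside F hF1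
    -- Small enough that `F < 3(1 - δ)`, so the side balls cover the points with `s ≤ δ` and `N >
    -- 0`.
    obtain ⟨δ, hδ⟩ : ∃ δ, δ = (3 - F) / 6 := ⟨_, rfl⟩
    have hδ0 : 0 < δ := by rw [hδ]; linarith
    have hδR : 3 / (4 * (3 - eta)) < 3 * (1 + δ) ^ 2 / (4 * (3 - eta)) - δ := by
      rw [lt_sub_iff_add_lt, div_add' _ _ _ (by positivity), div_lt_div_iff_of_pos_right
        (by positivity)]
      nlinarith
    have hlt := lt_min hF4 hδR
    have hsq := Real.sq_sqrt (hR.trans hlt).le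
    have hpos := Real.sqrt_pos.2 (hR.trans hlt)
    refine ⟨_, hpos, hlt.trans_eq hsq.symm, ?_⟩
    intro l₁ l₂ l₃ hl₁ hl₂ hl₃ hs hN
    rcases lt_or_ge (δ * (1 - (l₁ + l₂ + l₃))) ((l₁ + l₂ + l₃) * (1 - (l₁ + l₂ + l₃)) +
      eta * (l₁ * l₂ + l₁ * l₃ + l₂ * l₃)) with hb | hb
    · exact h.notMem_rHulloid_of_base (by linarith) v hδ0.le hpos
        (hsq.le.trans (min_le_right _ _)) hb
    · refine h.notMem_rHulloid_of_sides h0 (by linarith) v hF0.le hpos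
        (hsq.le.trans (min_le_left _ _)) ?_
      have hs1 : 0 < 1 - (l₁ + l₂ + l₃) :=
        pos_of_mul_pos_right (hN.trans_le hb) hδ0.le
      have hP : 0 ≤ eta * (l₁ * l₂ + l₁ * l₃ + l₂ * l₃) := by positivity
      -- Outside the base ball, `s(1 - s) ≤ N ≤ δ(1 - s)`: only points near the apex remain.
      have hsδ : l₁ + l₂ + l₃ ≤ δ := le_of_mul_le_mul_right (by linarith) hs1
      have key := mul_min_le_pyramid_power h0.le hl₁ hl₂ hl₃ hs
      rcases (le_min hl₁ (le_min hl₂ hl₃)).eq_or_lt with hm | hm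
      · rwa [← hm, mul_zero]
      · refine (mul_lt_mul_of_pos_right ?_ hm).trans_le key
        have : 0 ≤ eta * (l₁ + l₂ + l₃) := by positivity
        linarith

/-- Both terms of `N` are nonnegative, so both vanish: at most one `lᵢ` is nonzero, and `s` is 0 or
1. -/
theorem combination_mem_vertices (h0 : 0 < eta) {l₁ l₂ l₃ : ℝ} (v : E) (h₁ : 0 ≤ l₁)
    (h₂ : 0 ≤ l₂) (h₃ : 0 ≤ l₃) (hs : l₁ + l₂ + l₃ ≤ 1)
    (hN : (l₁ + l₂ + l₃) * (1 - (l₁ + l₂ + l₃)) + eta * (l₁ * l₂ + l₁ * l₃ + l₂ * l₃) ≤ 0) :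
    v + (l₁ • e₁ + l₂ • e₂ + l₃ • e₃) ∈ ({v, v + e₁, v + e₂, v + e₃} : Set E) := by
  have p12 := mul_nonneg h₁ h₂
  have p13 := mul_nonneg h₁ h₃
  have p23 := mul_nonneg h₂ h₃
  have pP := mul_nonneg h0.le (add_nonneg (add_nonneg p12 p13) p23)
  have pS : 0 ≤ (l₁ + l₂ + l₃) * (1 - (l₁ + l₂ + l₃)) :=
    mul_nonneg (by linarith) (by linarith)
  have hP : l₁ * l₂ + l₁ * l₃ + l₂ * l₃ = 0 :=
    (mul_eq_zero.1 (le_antisymm (by linarith) pP)).resolve_left h0.ne'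
  have q12 : l₁ * l₂ = 0 := by linarith
  have q13 : l₁ * l₃ = 0 := by linarith
  have q23 : l₂ * l₃ = 0 := by linarith
  rcases mul_eq_zero.1 (le_antisymm (by linarith) pS) with hS | hS
  · obtain rfl : l₁ = 0 := by linarith
    obtain rfl : l₂ = 0 := by linarith
    obtain rfl : l₃ = 0 := by linarith
    simp
  · rcases mul_eq_zero.1 q12 with rfl | rfl
    · rcases mul_eq_zero.1 q23 with rfl | rfl
      · obtain rfl : l₃ = 1 := by linarith
        simp
      · obtain rfl : l₂ = 1 := by linarith
        simp
    · rcases mul_eq_zero.1 q13 with rfl | rfl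
      · obtain rfl : l₃ = 1 := by linarith
        simp
      · obtain rfl : l₁ = 1 := by linarith
        simp

end IsPyramidFrame

end Pyramid

/-! ### Passage from the frame to the tetrahedron. -/

theorem subset_rHulloid {E : Type*} [PseudoMetricSpace E] (r : ℝ) (S : Set E) :
    S ⊆ rHulloid r S :=
  fun _ hx _ hA => hA.2 hx

theorem IsTriangularPyramid.isPyramidFrame {eta : ℝ}
    {T : Affine.Simplex ℝ (EuclideanSpace ℝ (Fin 3)) 3} (hT : IsTriangularPyramid T 1 eta) :
    IsPyramidFrame eta (T.points 1 - T.points 0) (T.points 2 - T.points 0)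
      (T.points 3 - T.points 0) := by
  have hd : ∀ i : Fin 4, i ≠ 0 → ‖T.points i - T.points 0‖ ^ 2 = 1 := fun i hi => by
    rw [← dist_eq_norm, dist_comm, hT.lateral i hi]
  have hi : ∀ i j : Fin 4, i ≠ 0 → j ≠ 0 → i ≠ j →
      inner ℝ (T.points i - T.points 0) (T.points j - T.points 0) = 1 - eta / 2 := by
    intro i j hi hj hij
    have h1 := norm_sub_sq_real (T.points i - T.points 0) (T.points j - T.points 0)
    rw [sub_sub_sub_cancel_right, ← dist_eq_norm, hT.base i j hi hj hij, hd i hi, hd j hj] at h1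
    linarith
  constructor
  · rw [real_inner_self_eq_norm_sq, hd 1 (by decide)]
  · rw [real_inner_self_eq_norm_sq, hd 2 (by decide)]
  · rw [real_inner_self_eq_norm_sq, hd 3 (by decide)]
  · exact hi 1 2 (by decide) (by decide) (by decide)
  · exact hi 1 3 (by decide) (by decide) (by decide)
  · exact hi 2 3 (by decide) (by decide) (by decide)

theorem IsTriangularPyramid.circumradius_sq {eta : ℝ} (h3 : eta < 3)
    {T : Affine.Simplex ℝ (EuclideanSpace ℝ (Fin 3)) 3} (hT : IsTriangularPyramid T 1 eta) :
    T.circumradius ^ 2 = 3 / (4 * (3 - eta)) := by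
  have hf := hT.isPyramidFrame
  -- Power 0 at the apex makes the axial sphere the circumsphere.
  obtain ⟨w, i1, i2, i3, hw⟩ := hf.exists_axial_center h3 0
  have hspan : T.points 0 + w ∈ affineSpan ℝ (Set.range T.points) := by
    rw [T.independent.affineSpan_eq_top_iff_card_eq_finrank_add_one.2 (by simp)]
    exact AffineSubspace.mem_top _ _ _
  rw [← T.eq_circumradius_of_dist_eq hspan (r := ‖w‖) ?_, hw]
  · ring
  have key : ∀ i, ‖w - (T.points i - T.points 0)‖ ^ 2 = ‖w‖ ^ 2 →
      dist (T.points i) (T.points 0 + w) = ‖w‖ := fun i hi => by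
    rw [dist_comm, dist_eq_norm, ← (sq_eq_sq₀ (norm_nonneg _) (norm_nonneg _)).1 hi]
    congr 1
    abel
  intro i
  refine key i ?_
  fin_cases i
  · simp
  · exact (hf.norm_sub_sq_edge₁ w).trans (by rw [i1]; ring)
  · exact (hf.rotate.norm_sub_sq_edge₁ w).trans (by rw [i2]; ring)
  · exact (hf.rotate.rotate.norm_sub_sq_edge₁ w).trans (by rw [i3]; ring)

theorem rHulloid_range_subset_image_stdSimplex {ι E : Type*} [Fintype ι] [Nonempty ι]
    [NormedAddCommGroup E] [InnerProductSpace ℝ E] {r : ℝ} (hr : 0 < r) (p : ι → E) :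
    rHulloid r (Set.range p) ⊆ Fintype.linearCombination ℝ p '' stdSimplex ℝ ι := by
  classical
  refine rHulloid_subset_of_isCompact_convex hr (Set.range_nonempty p) ?_
    ((isCompact_stdSimplex ℝ ι).image ?_) ((convex_stdSimplex ℝ ι).linear_image _)
  · rintro _ ⟨i, rfl⟩
    exact ⟨_, single_mem_stdSimplex ℝ i, by simp [Fintype.linearCombination_apply_single]⟩
  · exact LinearMap.continuous_on_pi _

theorem mainTheorem8 (eta : ℝ) (heta0 : 0 < eta) (heta1 : eta < 12 / 5)
    (T : Affine.Simplex ℝ (EuclideanSpace ℝ (Fin 3)) 3) (hT : IsTriangularPyramid T 1 eta) :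
    ∃ r : ℝ, T.circumradius < r ∧ rHulloid r (Set.range T.points) = Set.range T.points := by
  have hV : Set.range T.points = {T.points 0, T.points 0 + (T.points 1 - T.points 0),
      T.points 0 + (T.points 2 - T.points 0), T.points 0 + (T.points 3 - T.points 0)} := by
    ext x
    simp [Fin.exists_fin_succ, eq_comm]
  obtain ⟨r, hr, hRr, hcov⟩ := hT.isPyramidFrame.exists_radius heta0 heta1 (T.points 0)
  rw [← hT.circumradius_sq (by linarith)] at hRr
  refine ⟨r, lt_of_pow_lt_pow_left₀ 2 hr.le hRr, (subset_rHulloid _ _).antisymm' ?_⟩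
  intro x hx
  obtain ⟨l, ⟨hl0, hl1⟩, hlx⟩ := rHulloid_range_subset_image_stdSimplex hr _ hx
  rw [Fin.sum_univ_four] at hl1
  have hx' : x = T.points 0 + (l 1 • (T.points 1 - T.points 0) + l 2 • (T.points 2 - T.points 0) +
      l 3 • (T.points 3 - T.points 0)) := by
    rw [← hlx, Fintype.linearCombination_apply, Fin.sum_univ_four,
      show l 0 = 1 - l 1 - l 2 - l 3 by linarith]
    module
  rw [hx', hV] at hx ⊢
  have hs : l 1 + l 2 + l 3 ≤ 1 := by linarith [hl0 0]
  by_contra hmem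
  refine hcov _ _ _ (hl0 1) (hl0 2) (hl0 3) hs (lt_of_not_ge fun hN => hmem ?_) hx
  exact IsPyramidFrame.combination_mem_vertices heta0 _ (hl0 1) (hl0 2) (hl0 3) hs hN
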